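/- Let $X$ be a real locally convex Hausdorff topological vector space, and let $f$ and $f_k$ ($k\in\mathbb N=\{1,2,\dots\}$) be proper convex lower semicontinuous functions $X\to\mathbb R\cup\{+\infty\}$. Consider the problem $$(\mathrm P_{\mathbb N})\qquad \inf f(x)\ \text{ s.t. } f_k(x)\le 0,\ k\in\mathbb N,$$ its finite subproblems $$(\mathrm P_m)\qquad \inf f(x)\ \text{ s.t. } f_k(x)\le 0,\ k\in\{1,\dots,m\},$$ and the Lagrangian duals (with the rule $0\times(+\infty)=0$) $$(\mathrm D_m)\quad \sup_{\mu\in\mathbb R_+^m}\ \inf_{x\in X}\Big\{f(x)+\sum_{k=1}^m\mu_kf_k(x)\Big\},\qquad (\mathrm D_{\mathbb N})\quad \sup_{\lambda\in\mathbb R_+^{(\mathbb N)}}\ \inf_{x\in X}\Big\{f(x)+\sum_{k\in\mathbb N}\lambda_kf_k(x)\Big\},$$ where $\mathbb R_+^{(\mathbb N)}$ is the set of finitely supported sequences of nonnegative reals. For a proper convex lower semicontinuous function $h$, let $h_\infty$ be its recession function, i.e. the function whose epigraph is the recession cone of the epigraph of $h$, and put $$(\mathrm P)_\infty:=\bigcap_{k\in\mathbb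 N}\{x\in X: (f_k)_\infty(x)\le 0\}\cap\{x\in X: f_\infty(x)\le0\}.$$ Call $h$ weakly inf-locally compact if the sublevel set $\{x\in X: h(x)\le r\}$ is locally compact in the weak topology of $X$ for every $r\in\mathbb R$. Assume that $\inf(\mathrm P_{\mathbb N})\ne+\infty$ and that (g) there exist $N\in\mathbb N$ and $\mu\in\mathbb R_+^N$ such that $f+\sum_{k=1}^N\mu_kf_k$ is weakly inf-locally compact; (e) $(\mathrm P)_\infty$ is a linear subspace of $X$. Then $\inf(\mathrm P_{\mathbb N})$ is a real number, it is attained, and $$\min(\mathrm P_{\mathbb N})=\lim_{m\to\infty}\inf(\mathrm P_m)=\lim_{m\to\infty}\sup(\mathrm D_m)=\sup(\mathrm D_{\mathbb N}).$$ Moreover, the optimal solution set of $(\mathrm P_{\mathbb N})$ is the sum of a weakly compact convex set and a finite-dimensional linear subspace of $X$. -/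

import Mathlib

open Filter Topology Set
open scoped NNReal Pointwise

namespace InfConvex

section Functions

variable {X : Type*} [AddCommGroup X] [Module ℝ X]

/-- The epigraph of `h`, a subset of `X × ℝ`. -/
def epi (h : X → EReal) : Set (X × ℝ) := {p | h p.1 ≤ (p.2 : EReal)}

/-- `h` is proper: its epigraph is nonempty and it never takes the value `-∞`. -/
def Proper (h : X → EReal) : Prop := (epi h).Nonempty ∧ ∀ x, h x ≠ ⊥

/-- The class `Γ(X)` of lower semicontinuous proper convex functions on `X`. -/
structure IsGamma [TopologicalSpace X] (h : X → EReal) : Prop where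
  proper : Proper h
  convex : Convex ℝ (epi h)
  lsc : LowerSemicontinuous h

/-- The recession cone `A_∞` of a convex subset `A` of a real vector space. -/
def recCone {V : Type*} [AddCommGroup V] [Module ℝ V] (A : Set V) : Set V :=
  {d | ∀ a ∈ A, ∀ t : ℝ, 0 ≤ t → a + t • d ∈ A}

/-- The recession function `h_∞` of `h`, the function whose epigraph is `(epi h)_∞`
(see `epi_recFun`). -/
noncomputable def recFun (h : X → EReal) (d : X) : EReal :=
  ⨅ s ∈ {s : ℝ | (d, s) ∈ recCone (epi h)}, (s : EReal)

/-- The defining property of the recession function: `epi h_∞ = (epi h)_∞`. -/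
theorem epi_recFun (h : X → EReal) : epi (recFun h) = recCone (epi h) := by
  ext ⟨d, s⟩
  constructor
  · rintro hs ⟨x, r⟩ hx t ht
    have key : ∀ s' : ℝ, s < s' → h (x + t • d) ≤ ((r + t * s' : ℝ) : EReal) := by
      intro s' hss
      have hlt : recFun h d < (s' : EReal) :=
        lt_of_le_of_lt hs (EReal.coe_lt_coe_iff.2 hss)
      obtain ⟨s₀, h1⟩ := iInf_lt_iff.1 hlt
      obtain ⟨h2, h3⟩ := iInf_lt_iff.1 h1
      have h4 : h (x + t • d) ≤ ((r + t * s₀ : ℝ) : EReal) := h2 (x, r) hx t ht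
      refine h4.trans (EReal.coe_le_coe_iff.2 ?_)
      have := mul_le_mul_of_nonneg_left (EReal.coe_lt_coe_iff.1 h3).le ht
      linarith
    change h (x + t • d) ≤ ((r + t * s : ℝ) : EReal)
    have hlim : Tendsto (fun s' : ℝ => ((r + t * s' : ℝ) : EReal)) (𝓝[>] s)
        (𝓝 ((r + t * s : ℝ) : EReal)) := by
      have hc : Continuous fun s' : ℝ => ((r + t * s' : ℝ) : EReal) :=
        continuous_coe_real_ereal.comp (by fun_prop)
      exact hc.continuousWithinAt
    exact ge_of_tendsto hlim (by
      filter_upwards [self_mem_nhdsWithin] with s' hs'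
      exact key s' hs')
  · intro hs
    exact iInf₂_le (f := fun (s : ℝ) (_ : s ∈ {s : ℝ | (d, s) ∈ recCone (epi h)}) => (s : EReal)) s hs

end Functions

section WeakTopology

variable {X : Type*} [AddCommGroup X] [Module ℝ X] [TopologicalSpace X]

/-- `A` is locally compact for the topology induced by the weak topology of `X`. -/
def WeaklyLocallyCompact (A : Set X) : Prop := LocallyCompactSpace (toWeakSpace ℝ X '' A)

/-- `A` is compact for the weak topology of `X`. -/
def WeaklyCompact (A : Set X) : Prop := IsCompact (toWeakSpace ℝ X '' A)

/-- `h` is weakly inf-locally compact: every sublevel set `[h ≤ r]`, `r ∈ ℝ`, is weakly locally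
compact. -/
def WeaklyInfLocallyCompact (h : X → EReal) : Prop :=
  ∀ r : ℝ, WeaklyLocallyCompact {x | h x ≤ (r : EReal)}

end WeakTopology

section Program

variable {X T : Type*}

/-- The feasible set `{x | F t x ≤ 0 for all t ∈ S}` for the constraints with index in `S`. -/
def feasible (F : T → X → EReal) (S : Set T) : Set X := {x | ∀ t ∈ S, F t x ≤ 0}

/-- The optimal value of: minimize `f x` subject to `F t x ≤ 0` for all `t ∈ S`. -/
noncomputable def infP (f : X → EReal) (F : T → X → EReal) (S : Set T) : EReal :=
  ⨅ x ∈ feasible F S, f x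

/-- The optimal solution set of: minimize `f x` subject to `F t x ≤ 0` for all `t ∈ S`. -/
def sol (f : X → EReal) (F : T → X → EReal) (S : Set T) : Set X :=
  {x ∈ feasible F S | f x = infP f F S}

/-- `f + ∑_{t ∈ H} μ_t f_t` for a finite index set `H` and `μ ∈ ℝ₊^H`. In `EReal` one has
`0 * ⊤ = 0`. -/
noncomputable def lagrangian (f : X → EReal) (F : T → X → EReal) (H : Finset T) (μ : H → ℝ≥0)
    (x : X) : EReal :=
  f x + ∑ t : H, ((μ t : ℝ) : EReal) * F t x

/-- The value of the Lagrangian dual with finitely many constraints, indexed by `H`. -/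
noncomputable def supDFin (f : X → EReal) (F : T → X → EReal) (H : Finset T) : EReal :=
  ⨆ μ : H → ℝ≥0, ⨅ x : X, lagrangian f F H μ x

/-- The value of the Lagrangian-Haar dual, with multipliers the finitely supported nonnegative
families `l ∈ ℝ₊^(T)`. -/
noncomputable def supD (f : X → EReal) (F : T → X → EReal) : EReal :=
  ⨆ l : T →₀ ℝ≥0, ⨅ x : X, f x + ∑ t ∈ l.support, ((l t : ℝ) : EReal) * F t x

/-- The recession cone of the program: `⋂_t [(f_t)_∞ ≤ 0] ∩ [f_∞ ≤ 0]`. -/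
def recConeP [AddCommGroup X] [Module ℝ X] (f : X → EReal) (F : T → X → EReal) : Set X :=
  (⋂ t, {x | recFun (F t) x ≤ 0}) ∩ {x | recFun f x ≤ 0}

end Program

end InfConvex

/-! Everything takes place in the weak topology, which is again locally convex and Hausdorff and in
which functions of class `IsGamma` stay lower semicontinuous. Let L be the recession cone of the
program, a subspace by (e). All the functions are constant along L, so by (g) a translate of L is a
closed part of a locally compact set, and L is finite-dimensional. It therefore has a closed
complement Y, and nothing is lost by restricting the program to Y.

On Y the recession cones of the subproblems decrease to L ∩ Y = 0. One of them is locally compact,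
so compactness of a seminorm slice makes them trivial from some m₀ on (`exists_cone_subset_zero`). A
closed convex locally compact set without rays is compact (`isCompact_of_locallyCompact_of_no_ray`),
so on Y the joint sublevel sets of the objective and the first m ≥ m₀ constraints are compact.
Attainment and the form of the solution set follow.

For α below the optimal value v, compactness shows that for large m no point of Y has f ≤ α and f_k
≤ 0 for k ≤ m. The attainable level vectors form a closed convex upper set in a finite-dimensional
space; separation with positive weights (`exists_pos_weights`) gives α ≤ sup(D_m). Weak duality
squeezes all values to v. -/

namespace InfConvex

/-! ### Recession directions of convex lower semicontinuous functions. -/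

section Recession

variable {E : Type*} [AddCommGroup E] [Module ℝ E]

theorem recFun_le_zero_iff {h : E → EReal} {d : E} :
    recFun h d ≤ 0 ↔
      ∀ x (r : ℝ), h x ≤ (r : EReal) → ∀ t : ℝ, 0 ≤ t → h (x + t • d) ≤ (r : EReal) := by
  have : recFun h d ≤ 0 ↔ (d, (0 : ℝ)) ∈ epi (recFun h) := by simp [epi]
  rw [this, epi_recFun]
  simp [recCone, epi]

theorem apply_add_smul_le_of_recFun_le_zero {h : E → EReal} (hbot : ∀ x, h x ≠ ⊥) {d : E}
    (hd : recFun h d ≤ 0) (x : E) {t : ℝ} (ht : 0 ≤ t) : h (x + t • d) ≤ h x := by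
  rcases eq_or_ne (h x) ⊤ with hx | hx
  · simp [hx]
  · lift h x to ℝ using ⟨hx, hbot x⟩ with r hr
    exact recFun_le_zero_iff.1 hd x r hr.ge t ht

theorem apply_add_eq_of_recFun_le_zero {h : E → EReal} (hbot : ∀ x, h x ≠ ⊥) {d : E}
    (hd : recFun h d ≤ 0) (hd' : recFun h (-d) ≤ 0) (x : E) : h (x + d) = h x := by
  apply le_antisymm
  · simpa using apply_add_smul_le_of_recFun_le_zero hbot hd x zero_le_one
  · simpa using apply_add_smul_le_of_recFun_le_zero hbot hd' (x + d) zero_le_one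

theorem convex_sublevel_of_convex_epi {h : E → EReal} (hc : Convex ℝ (epi h)) (r : ℝ) :
    Convex ℝ {x | h x ≤ (r : EReal)} := by
  intro x hx y hy a b ha hb hab
  have := @hc (x, r) hx (y, r) hy a b ha hb hab
  have e : a * r + b * r = r := by rw [← add_mul, hab, one_mul]
  simpa [epi, ← EReal.coe_mul, ← EReal.coe_add, e] using this

theorem recFun_smul_le_zero {h : E → EReal} {d : E} (hd : recFun h d ≤ 0) {t : ℝ} (ht : 0 ≤ t) :
    recFun h (t • d) ≤ 0 := by
  rw [recFun_le_zero_iff] at hd ⊢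
  intro x r hx s hs
  rw [smul_smul]
  exact hd x r hx _ (mul_nonneg hs ht)

variable [TopologicalSpace E]

theorem IsGamma.isClosed_sublevel {h : E → EReal} (hh : IsGamma h) (r : EReal) :
    IsClosed {x | h x ≤ r} :=
  hh.lsc.isClosed_preimage r

variable [IsTopologicalAddGroup E] [ContinuousSMul ℝ E]

/-- A single ray in a sublevel set is enough to get a recession direction. -/
theorem IsGamma.recFun_le_zero_of_ray {h : E → EReal} (hh : IsGamma h) {x₀ d : E} {r₀ : ℝ}
    (hray : ∀ t : ℝ, 0 ≤ t → h (x₀ + t • d) ≤ (r₀ : EReal)) : recFun h d ≤ 0 := by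
  rw [recFun_le_zero_iff]
  intro x r hx t ht
  by_contra! hlt
  obtain ⟨c, hrc, hch⟩ := EReal.lt_iff_exists_real_btwn.1 hlt
  have hrc : r < c := EReal.coe_lt_coe_iff.1 hrc
  -- These points are (1 - s)x + s(x₀ + (t/s)d): going far along the given ray with small weight s
  -- recovers the displacement t • d from x, at a level tending to r.
  have hlim : Tendsto (fun s : ℝ => x + s • (x₀ - x) + t • d) (𝓝[>] 0) (𝓝 (x + t • d)) := by
    have : Continuous fun s : ℝ => x + s • (x₀ - x) + t • d := by fun_prop
    simpa using (this.tendsto 0).mono_left nhdsWithin_le_nhds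
  have hlim' : Tendsto (fun s : ℝ => (1 - s) * r + s * r₀) (𝓝[>] 0) (𝓝 r) := by
    have : Continuous fun s : ℝ => (1 - s) * r + s * r₀ := by fun_prop
    simpa using (this.tendsto 0).mono_left nhdsWithin_le_nhds
  have hmem : x + t • d ∈ {x | h x ≤ (c : EReal)} := by
    refine (hh.isClosed_sublevel c).mem_of_tendsto hlim ?_
    filter_upwards [self_mem_nhdsWithin, Ioo_mem_nhdsGT (zero_lt_one' ℝ),
      hlim'.eventually (gt_mem_nhds hrc)] with s hs0 hs1 hs2
    have hs0 : 0 < s := hs0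
    have := @hh.convex (x, r) hx (x₀ + (t / s) • d, r₀) (hray _ (by positivity)) (1 - s) s
      (by linarith [hs1.2]) hs0.le (by ring)
    have h1 : h ((1 - s) • x + s • (x₀ + (t / s) • d)) ≤ (((1 - s) * r + s * r₀ : ℝ) : EReal) := this
    have h2 : (1 - s) • x + s • (x₀ + (t / s) • d) = x + s • (x₀ - x) + t • d := by
      rw [smul_add, smul_smul, mul_div_cancel₀ _ hs0.ne']
      module
    rw [h2] at h1
    exact h1.trans (EReal.coe_le_coe_iff.2 hs2.le)
  exact absurd hmem (not_le.2 hch)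

/-- Since one ray from one point of the domain decides, the cone is an intersection of preimages of
a single closed sublevel set. -/
theorem IsGamma.isClosed_recFun_le_zero {h : E → EReal} (hh : IsGamma h) :
    IsClosed {d | recFun h d ≤ 0} := by
  obtain ⟨⟨x₀, r₀⟩, hx₀⟩ := hh.proper.1
  have : {d | recFun h d ≤ 0} =
      ⋂ (t : ℝ) (_ : 0 ≤ t), (fun d => x₀ + t • d) ⁻¹' {x | h x ≤ (r₀ : EReal)} := by
    ext d
    simp only [mem_iInter, mem_preimage, mem_ofPred_eq]
    exact ⟨fun hd => recFun_le_zero_iff.1 hd x₀ r₀ hx₀, hh.recFun_le_zero_of_ray⟩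
  rw [this]
  exact isClosed_biInter fun t _ => (hh.isClosed_sublevel r₀).preimage (by fun_prop)

end Recession

/-! ### Compactness from local compactness and absence of rays. -/

section Compactness

variable {E : Type*} [AddCommGroup E] [Module ℝ E] [TopologicalSpace E]
  [IsTopologicalAddGroup E] [ContinuousSMul ℝ E] [LocallyConvexSpace ℝ E]

theorem exists_continuous_seminorm_unitBall_subset {V : Set E} (hV : V ∈ 𝓝 (0 : E)) :
    ∃ p : Seminorm ℝ E, Continuous p ∧ ∀ x, p x ≤ 1 → x ∈ V := by
  have hW := PolynormableSpace.withSeminorms ℝ E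
  obtain ⟨⟨s, r⟩, hr, hs⟩ := hW.hasBasis_zero_ball.mem_iff.1 hV
  have hr : 0 < r := hr
  let p : Seminorm ℝ E := s.sup fun q : {q : Seminorm ℝ E // Continuous q} => (q : Seminorm ℝ E)
  have hp : Continuous p := by
    refine Seminorm.continuous (r := 1) ?_
    exact hW.hasBasis_zero_ball.mem_of_mem (i := (s, 1)) one_pos
  let c : ℝ≥0 := ⟨2 / r, by positivity⟩
  refine ⟨c • p, ?_, fun x hx => hs ?_⟩
  · exact hp.const_smul c
  · have : 2 / r * p x ≤ 1 := hx
    rw [Seminorm.mem_ball_zero]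
    change p x < r
    have h2 : 2 * p x ≤ r := by
      rw [div_mul_eq_mul_div, div_le_iff₀ hr] at this
      linarith
    have := apply_nonneg p x
    linarith

/-- A continuous seminorm that does not vanish at z is bounded by some M on K but unbounded along
the ray; the parameter (2M + 1) / q z already violates the triangle inequality. -/
theorem eq_zero_of_ray_subset_compact [T2Space E] {K : Set E} (hK : IsCompact K) {a z : E}
    (h : ∀ t : ℝ, 0 ≤ t → a + t • z ∈ K) : z = 0 := by
  by_contra hz
  obtain ⟨⟨q, hq⟩, hqz⟩ := (PolynormableSpace.withSeminorms ℝ E).separating_of_T1 z hz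
  have hqz : 0 < q z := lt_of_le_of_ne (apply_nonneg q z) (Ne.symm hqz)
  obtain ⟨M, hM⟩ := hK.bddAbove_image hq.continuousOn
  have hb : ∀ x ∈ K, q x ≤ M := fun x hx => hM (mem_image_of_mem _ hx)
  have ha : 0 ≤ q a := apply_nonneg q a
  have haM : q a ≤ M := hb a (by simpa using h 0 le_rfl)
  have hM0 : 0 ≤ M := ha.trans haM
  have ht : 0 ≤ (2 * M + 1) / q z := by positivity
  have h1 := hb _ (h _ ht)
  have h2 : q (((2 * M + 1) / q z) • z) = 2 * M + 1 := by
    rw [map_smul_eq_mul, Real.norm_of_nonneg ht, div_mul_cancel₀ _ hqz.ne']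
  have h3 := map_sub_le_add q (a + ((2 * M + 1) / q z) • z) a
  rw [add_sub_cancel_left, h2] at h3
  linarith

/-- A compact neighbourhood of a in C contains the part of C in a seminorm ball around a, and that
part is closed. -/
theorem exists_seminorm_isCompact_of_locallyCompact {C : Set E} (hC : IsClosed C)
    (hlc : LocallyCompactSpace C) {a : E} (ha : a ∈ C) :
    ∃ p : Seminorm ℝ E, Continuous p ∧ IsCompact {x | a + x ∈ C ∧ p x ≤ 1} := by
  obtain ⟨K, hK, hKn⟩ := exists_compact_mem_nhds (⟨a, ha⟩ : C)
  obtain ⟨V, hV, hVK⟩ := mem_nhds_subtype C ⟨a, ha⟩ K |>.1 hKn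
  have hV0 : (fun x => a + x) ⁻¹' V ∈ 𝓝 (0 : E) :=
    (continuous_const_add a).continuousAt.preimage_mem_nhds (by simpa using hV)
  obtain ⟨p, hp, hpV⟩ := exists_continuous_seminorm_unitBall_subset hV0
  refine ⟨p, hp, ?_⟩
  have hK' : IsCompact ((fun y : E => y - a) '' (Subtype.val '' K)) :=
    (hK.image continuous_subtype_val).image (by fun_prop)
  refine hK'.of_isClosed_subset ?_ ?_
  · exact (hC.preimage (continuous_const_add a)).inter (isClosed_le hp continuous_const)
  · rintro x ⟨hx, hpx⟩
    exact ⟨a + x, ⟨⟨a + x, hx⟩, hVK (hpV x hpx), rfl⟩, by simp⟩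

/-- A closed convex locally compact set without recession directions is compact. -/
theorem isCompact_of_locallyCompact_of_no_ray {C : Set E} (hC : IsClosed C) (hconv : Convex ℝ C)
    (hlc : LocallyCompactSpace C) {a : E} (ha : a ∈ C)
    (hray : ∀ d, (∀ t : ℝ, 0 ≤ t → a + t • d ∈ C) → d = 0) : IsCompact C := by
  obtain ⟨p, hp, hK⟩ := exists_seminorm_isCompact_of_locallyCompact hC hlc ha
  have hstar : ∀ {x : E} {s t : ℝ}, a + t • x ∈ C → 0 ≤ s → s ≤ t → a + s • x ∈ C := by
    intro x s t hx hs hst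
    rcases hs.eq_or_lt with rfl | hs'
    · simpa using ha
    have ht : 0 < t := hs'.trans_le hst
    have := hconv ha hx (a := 1 - s / t) (b := s / t) (by rw [sub_nonneg, div_le_one ht]; exact hst)
      (by positivity) (by ring)
    convert this using 1
    rw [smul_add, smul_smul, div_mul_cancel₀ _ ht.ne']
    module
  -- A point common to all D n would span a ray in C although p is at least 1 there. Hence finitely
  -- many D n already miss the compact slice, which bounds p on C - a and puts C inside a dilate of
  -- that slice.
  let D : ℕ → Set E := fun n => {z | 1 ≤ p z} ∩ {z | a + (n : ℝ) • z ∈ C}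
  have hDc : ∀ n, IsClosed (D n) := fun n =>
    (isClosed_le continuous_const hp).inter (hC.preimage (by fun_prop))
  have hex : ∃ u : Finset ℕ, {x | a + x ∈ C ∧ p x ≤ 1} ∩ ⋂ i ∈ u, D i = ∅ := by
    refine hK.elim_finite_subfamily_closed D hDc ?_
    rw [eq_empty_iff_forall_notMem]
    rintro z ⟨-, hz⟩
    rw [mem_iInter] at hz
    have h0 : z = 0 := by
      refine hray z fun t ht => ?_
      obtain ⟨n, hn⟩ := exists_nat_ge t
      exact hstar (hz n).2 ht hn
    have : 1 ≤ p z := (hz 0).1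
    simp [h0] at this
    linarith
  obtain ⟨u, hu⟩ := hex
  let n : ℕ := u.sup id + 1
  have hn1 : (1 : ℝ) ≤ n := by simp [n]
  have hbound : ∀ x, a + x ∈ C → p x ≤ n := by
    intro x hx
    by_contra! hlt
    have hpx : 0 < p x := by linarith
    rw [eq_empty_iff_forall_notMem] at hu
    refine hu ((p x)⁻¹ • x) ⟨⟨?_, ?_⟩, ?_⟩
    · refine hstar (t := 1) (by simpa using hx) (by positivity) (inv_le_one_of_one_le₀ (by linarith))
    · rw [map_smul_eq_mul, Real.norm_of_nonneg (by positivity), inv_mul_cancel₀ hpx.ne']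
    · simp only [mem_iInter]
      intro i hi
      refine ⟨?_, ?_⟩
      · change 1 ≤ p _
        rw [map_smul_eq_mul, Real.norm_of_nonneg (by positivity), inv_mul_cancel₀ hpx.ne']
      · change a + (i : ℝ) • (p x)⁻¹ • x ∈ C
        rw [smul_smul]
        refine hstar (t := 1) (by simpa using hx) (by positivity) ?_
        have : (i : ℝ) ≤ n := by
          have : i ≤ u.sup id := Finset.le_sup (f := id) hi
          exact_mod_cast this.trans (Nat.le_succ _)
        rw [← div_eq_mul_inv, div_le_one hpx]
        linarith
  have himg : IsCompact ((fun x => a + (n : ℝ) • x) '' {x | a + x ∈ C ∧ p x ≤ 1}) :=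
    hK.image (by fun_prop)
  refine himg.of_isClosed_subset hC fun y hy => ?_
  have hy' : a + (y - a) ∈ C := by simpa using hy
  have hn0 : (0 : ℝ) < n := by linarith
  refine ⟨(n : ℝ)⁻¹ • (y - a), ⟨?_, ?_⟩, ?_⟩
  · exact hstar (t := 1) (by simpa using hy) (by positivity) (inv_le_one_of_one_le₀ hn1)
  · rw [map_smul_eq_mul, Real.norm_of_nonneg (by positivity), inv_mul_le_iff₀ hn0, mul_one]
    exact hbound _ hy'
  · simp [smul_smul]

/-- Nonzero directions can be normalised to p = 1, inside a compact slice of G N, where the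
decreasing intersection is empty and hence already empty at a finite stage. -/
theorem exists_cone_subset_zero [T2Space E] {G : ℕ+ → Set E} (hanti : Antitone G)
    (hcl : ∀ m, IsClosed (G m)) (hcone : ∀ m, ∀ d ∈ G m, ∀ t : ℝ, 0 ≤ t → t • d ∈ G m)
    (hzero : ∀ m, (0 : E) ∈ G m) {N : ℕ+} (hlc : LocallyCompactSpace (G N))
    (hinter : ∀ d, (∀ m, d ∈ G m) → d = 0) : ∃ m₀ ≥ N, ∀ d ∈ G m₀, d = 0 := by
  obtain ⟨p, hp, hK⟩ := exists_seminorm_isCompact_of_locallyCompact (hcl N) hlc (hzero N)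
  simp only [zero_add] at hK
  have hex : ∃ u : Finset ℕ+, {x | x ∈ G N ∧ p x ≤ 1} ∩ ⋂ i ∈ u, (G i ∩ {z | 1 ≤ p z}) = ∅ := by
    refine hK.elim_finite_subfamily_closed _
      (fun i => (hcl i).inter (isClosed_le continuous_const hp)) ?_
    rw [eq_empty_iff_forall_notMem]
    rintro z ⟨-, hz⟩
    rw [mem_iInter] at hz
    have h0 := hinter z fun m => (hz m).1
    have : 1 ≤ p z := (hz 1).2
    simp [h0] at this
    linarith
  obtain ⟨u, hu⟩ := hex
  obtain ⟨m₀, hm₀⟩ := (insert N u).exists_le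
  refine ⟨m₀, hm₀ N (Finset.mem_insert_self _ _), fun d hd => ?_⟩
  have hdN : d ∈ G N := hanti (hm₀ N (Finset.mem_insert_self _ _)) hd
  -- As p is only a seminorm, p d = 0 is possible; then the whole ray lies in the compact slice,
  -- which forces d = 0.
  rcases (apply_nonneg p d).eq_or_lt with h0 | hpos
  · refine eq_zero_of_ray_subset_compact hK (a := 0) fun t ht => ?_
    rw [zero_add]
    refine ⟨hcone N d hdN t ht, ?_⟩
    rw [map_smul_eq_mul, ← h0, mul_zero]
    exact zero_le_one
  · have hp1 : p ((p d)⁻¹ • d) = 1 := by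
      rw [map_smul_eq_mul, Real.norm_of_nonneg (by positivity), inv_mul_cancel₀ hpos.ne']
    rw [eq_empty_iff_forall_notMem] at hu
    refine absurd ?_ (hu ((p d)⁻¹ • d))
    refine ⟨⟨hcone N d hdN _ (by positivity), hp1.le⟩, ?_⟩
    simp only [mem_iInter]
    exact fun i hi => ⟨hcone i d (hanti (hm₀ i (Finset.mem_insert_of_mem hi)) hd) _
      (by positivity), hp1.ge⟩

end Compactness

/-! ### Separation from convex upper sets in finite dimension. -/

section Separation

variable {ι : Type*} [Fintype ι]

/-- Separation of a compact convex set from a closed convex upper set of `ℝ^ι`; the separating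
functional is nonnegative. -/
theorem exists_nonneg_separating {A K : Set (ι → ℝ)} (hA : Convex ℝ A) (hAc : IsClosed A)
    (hAu : IsUpperSet A) (hne : A.Nonempty) (hK : Convex ℝ K) (hKc : IsCompact K)
    (hdisj : Disjoint K A) :
    ∃ (ν : ι → ℝ) (u : ℝ), (∀ i, 0 ≤ ν i) ∧ (∀ k ∈ K, ∑ i, ν i * k i < u) ∧
      ∀ y ∈ A, u ≤ ∑ i, ν i * y i := by
  classical
  obtain ⟨φ, u, v, hφK, huv, hφA⟩ := geometric_hahn_banach_compact_closed hK hKc hA hAc hdisj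
  have hφ : ∀ y, φ y = ∑ i, φ (Pi.single i 1) * y i := by
    intro y
    conv_lhs => rw [pi_eq_sum_univ' y]
    rw [map_sum]
    refine Finset.sum_congr rfl fun i _ => ?_
    rw [map_smul, smul_eq_mul, mul_comm]
  refine ⟨fun i => φ (Pi.single i 1), v, fun i => ?_, fun k hk => ?_, fun y hy => ?_⟩
  -- With a negative i-th coefficient, moving a upwards along the i-th axis stays in A and lowers φ
  -- to exactly v, while φ > v on A.
  · by_contra! hneg
    obtain ⟨a, ha⟩ := hne
    have hc : 0 ≤ (φ a - v) / (-φ (Pi.single i 1)) :=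
      div_nonneg (by linarith [hφA a ha]) (by linarith)
    have hmem : a + ((φ a - v) / (-φ (Pi.single i 1))) • Pi.single i (1 : ℝ) ∈ A := by
      refine hAu ?_ ha
      refine le_add_of_nonneg_right (smul_nonneg hc ?_)
      exact Pi.single_nonneg.2 zero_le_one
    have := hφA _ hmem
    rw [map_add, map_smul, smul_eq_mul, div_mul_eq_mul_div, div_neg, mul_div_assoc,
      div_self hneg.ne] at this
    linarith
  · rw [← hφ]; exact (hφK k hk).trans huv
  · rw [← hφ]; exact (hφA y hy).le

/-- A point outside a closed convex upper set of `ℝ^ι` whose lower slices are bounded can be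
separated from it by a functional with positive coefficients. -/
theorem exists_pos_separating {A : Set (ι → ℝ)} (hA : Convex ℝ A) (hAc : IsClosed A)
    (hAu : IsUpperSet A) {a : ι → ℝ} (ha : a ∈ A) {c : ℝ}
    (hc : ∀ y ∈ A, y ≤ a → ∀ i, c ≤ y i) {p : ι → ℝ} (hp : p ∉ A) :
    ∃ w : ι → ℝ, (∀ i, 0 < w i) ∧ ∀ y ∈ A, ∑ i, w i * p i ≤ ∑ i, w i * y i := by
  classical
  obtain ⟨ν, u, hν, hνp, hνA⟩ := exists_nonneg_separating hA hAc hAu ⟨a, ha⟩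
    (convex_singleton p) isCompact_singleton (disjoint_singleton_left.2 hp)
  have hνp := hνp p rfl
  -- T is so large that every point a - T • e of the shifted simplex has coordinate sum below that
  -- of the constant vector c, hence lies outside A. Separating this simplex from A gives κ with κ i
  -- > 0, as each vertex lowers only one coordinate of a.
  let T : ℝ := ∑ i, (a i - c) + 1
  have hT : 0 < T := by
    have : 0 ≤ ∑ i, (a i - c) :=
      Finset.sum_nonneg fun i _ => sub_nonneg.2 (hc a ha le_rfl i)
    positivity
  let ψ : (ι → ℝ) → ι → ℝ := fun e => a - T • e
  have hK : Convex ℝ (ψ '' stdSimplex ℝ ι) := by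
    have : ψ '' stdSimplex ℝ ι = (fun z => a + z) '' ((-T) • stdSimplex ℝ ι) := by
      rw [← image_smul, image_image]
      refine image_congr fun e _ => ?_
      simp only [ψ]
      module
    rw [this]
    exact ((convex_stdSimplex ℝ ι).smul _).translate _
  have hKc : IsCompact (ψ '' stdSimplex ℝ ι) :=
    (isCompact_stdSimplex ℝ ι).image (by fun_prop)
  have hdisj : Disjoint (ψ '' stdSimplex ℝ ι) A := by
    rw [Set.disjoint_left]
    rintro _ ⟨e, he, rfl⟩ hmem
    have hle : ψ e ≤ a := by
      intro i
      have := mul_nonneg hT.le (he.1 i)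
      simp [ψ, this]
    have h1 : ∑ _i : ι, c ≤ ∑ i, ψ e i := Finset.sum_le_sum fun i _ => hc _ hmem hle i
    have h2 : ∑ i, ψ e i = ∑ i, a i - T := by
      simp [ψ, Finset.sum_sub_distrib, ← Finset.mul_sum, he.2]
    have h3 : T = ∑ i, a i - ∑ _i : ι, c + 1 := by
      simp only [T, Finset.sum_sub_distrib]
    linarith
  obtain ⟨κ, v, hκ, hκK, hκA⟩ := exists_nonneg_separating hA hAc hAu ⟨a, ha⟩ hK hKc hdisj
  have hκpos : ∀ i, 0 < κ i := by
    intro i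
    have h1 := hκK _ ⟨Pi.single i 1, single_mem_stdSimplex ℝ i, rfl⟩
    have h2 := hκA a ha
    have h3 : ∑ j, κ j * ψ (Pi.single i 1) j = ∑ j, κ j * a j - T * κ i := by
      simp [ψ, mul_sub, Finset.sum_sub_distrib, Pi.single_apply, mul_comm]
    rw [h3] at h1
    by_contra! h4
    have := mul_nonpos_of_nonneg_of_nonpos hT.le h4
    linarith
  -- A small multiple of κ makes ν positive, at a cost covered by the strict gap u - ∑ ν i * p i.
  obtain ⟨ε, hε, hεle⟩ : ∃ ε : ℝ, 0 < ε ∧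
      ∑ i, ν i * p i + ε * ∑ i, κ i * p i ≤ u + ε * v := by
    set P := ∑ i, κ i * p i
    set δ := u - ∑ i, ν i * p i with hδ
    have hδ0 : 0 < δ := by linarith
    refine ⟨δ / (|P - v| + 1), by positivity, ?_⟩
    have h1 : δ / (|P - v| + 1) * (P - v) ≤ δ := by
      rw [div_mul_eq_mul_div, div_le_iff₀ (by positivity)]
      exact mul_le_mul_of_nonneg_left (by linarith [le_abs_self (P - v)]) hδ0.le
    rw [mul_sub] at h1
    linarith
  have hsum : ∀ y : ι → ℝ, ∑ i, (ν i + ε * κ i) * y i =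
      ∑ i, ν i * y i + ε * ∑ i, κ i * y i := by
    intro y
    rw [Finset.mul_sum, ← Finset.sum_add_distrib]
    exact Finset.sum_congr rfl fun i _ => by ring
  refine ⟨fun i => ν i + ε * κ i, fun i => ?_, fun y hy => ?_⟩
  · have := mul_pos hε (hκpos i)
    have := hν i
    positivity
  · rw [hsum, hsum]
    refine hεle.trans (add_le_add (hνA y hy) ?_)
    exact mul_le_mul_of_nonneg_left (hκA y hy) hε.le

end Separation

/-! ### Attainable levels of a finite family of convex functions. -/

section FiniteFamily

theorem exists_lower_bound_on_compact {E : Type*} [TopologicalSpace E] {h : E → EReal} (hlsc : LowerSemicontinuous h)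
    (hbot : ∀ x, h x ≠ ⊥) {K : Set E} (hK : IsCompact K) :
    ∃ c : ℝ, ∀ x ∈ K, (c : EReal) ≤ h x := by
  rcases K.eq_empty_or_nonempty with rfl | hne
  · exact ⟨0, by simp⟩
  obtain ⟨a, -, ha⟩ := (hlsc.lowerSemicontinuousOn K).exists_isMinOn hne hK
  obtain ⟨c, -, hc⟩ := EReal.lt_iff_exists_real_btwn.1 (bot_lt_iff_ne_bot.2 (hbot a))
  exact ⟨c, fun x hx => hc.le.trans (ha hx)⟩

variable {E : Type*} [AddCommGroup E] [Module ℝ E] [TopologicalSpace E]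
  {ι : Type*} [Fintype ι]

/-- Convex functions with compact joint sublevel sets: an unattainable vector of levels is
excluded by a combination with positive weights. -/
theorem exists_pos_weights {h : ι → E → EReal} (hh : ∀ i, IsGamma (h i)) {Y : Set E}
    (hY : Convex ℝ Y) (hK : ∀ y : ι → ℝ, IsCompact {x | x ∈ Y ∧ ∀ i, h i x ≤ (y i : EReal)})
    {a : ι → ℝ} {x₀ : E} (hx₀ : x₀ ∈ Y) (ha : ∀ i, h i x₀ ≤ (a i : EReal)) {p : ι → ℝ}
    (hp : ∀ x ∈ Y, ¬ ∀ i, h i x ≤ (p i : EReal)) :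
    ∃ w : ι → ℝ, (∀ i, 0 < w i) ∧ ∀ x ∈ Y, ∀ y : ι → ℝ, (∀ i, h i x ≤ (y i : EReal)) →
      ∑ i, w i * p i ≤ ∑ i, w i * y i := by
  let A : Set (ι → ℝ) := {y | ∃ x ∈ Y, ∀ i, h i x ≤ (y i : EReal)}
  have hAu : IsUpperSet A := by
    rintro y z hyz ⟨x, hx, hxy⟩
    exact ⟨x, hx, fun i => (hxy i).trans (EReal.coe_le_coe_iff.2 (hyz i))⟩
  have hA : Convex ℝ A := by
    rintro y ⟨x, hx, hxy⟩ z ⟨x', hx', hxz⟩ s t hs ht hst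
    exact ⟨s • x + t • x', hY hx hx' hs ht hst, fun i =>
      @(hh i).convex (x, y i) (hxy i) (x', z i) (hxz i) s t hs ht hst⟩
  -- If y is not attained, nested compactness makes the joint sublevel set at y + 1/(n + 1) empty
  -- for some n, yet a point of A close to y puts an element in it.
  have hAc : IsClosed A := by
    refine isClosed_of_closure_subset fun y hy => ?_
    have hSc : ∀ n : ℕ, IsClosed {x | ∀ i, h i x ≤ ((y i + 1 / ((n : ℝ) + 1) : ℝ) : EReal)} := by
      intro n
      rw [ofPred_forall]
      exact isClosed_iInter fun i => (hh i).lsc.isClosed_preimage _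
    by_contra hyA
    have hex : ∃ n : ℕ, {x | x ∈ Y ∧ ∀ i, h i x ≤ ((y i + 1 / (((0 : ℕ) : ℝ) + 1) : ℝ) : EReal)} ∩
        {x | ∀ i, h i x ≤ ((y i + 1 / ((n : ℝ) + 1) : ℝ) : EReal)} = ∅ := by
      refine (hK _).elim_directed_family_closed _ hSc ?_ ?_
      · rw [eq_empty_iff_forall_notMem]
        rintro x ⟨hx, hx'⟩
        rw [mem_iInter] at hx'
        refine hyA ⟨x, hx.1, fun i => ?_⟩
        have hl : Tendsto (fun n : ℕ => ((y i + 1 / ((n : ℝ) + 1) : ℝ) : EReal)) atTop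
            (𝓝 ((y i : ℝ) : EReal)) := by
          refine (continuous_coe_real_ereal.tendsto _).comp ?_
          simpa using tendsto_one_div_add_atTop_nhds_zero_nat.const_add (y i)
        exact ge_of_tendsto' hl fun n => hx' n i
      · refine directed_of_isDirected_le fun m n hmn x hx i => (hx i).trans ?_
        exact EReal.coe_le_coe_iff.2 (by gcongr)
    obtain ⟨n, hn⟩ := hex
    have hU : {z : ι → ℝ | ∀ i, z i < y i + 1 / ((n : ℝ) + 1)} ∈ 𝓝 y := by
      rw [ofPred_forall]
      refine (isOpen_iInter_of_finite fun i => ?_).mem_nhds ?_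
      · exact isOpen_lt (by fun_prop) continuous_const
      · rw [mem_iInter]
        intro i
        have : 0 < 1 / ((n : ℝ) + 1) := by positivity
        change y i < _
        linarith
    obtain ⟨z, hz, x, hx, hxz⟩ := mem_closure_iff_nhds.1 hy _ hU
    rw [eq_empty_iff_forall_notMem] at hn
    have hxn : ∀ i, h i x ≤ ((y i + 1 / ((n : ℝ) + 1) : ℝ) : EReal) := fun i =>
      (hxz i).trans (EReal.coe_le_coe_iff.2 (hz i).le)
    refine hn x ⟨⟨hx, fun i => (hxn i).trans (EReal.coe_le_coe_iff.2 ?_)⟩, hxn⟩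
    gcongr
    exact n.cast_nonneg
  choose c hc using fun i => exists_lower_bound_on_compact (hh i).lsc (hh i).proper.2 (hK a)
  obtain ⟨c₀, hc₀⟩ := (Set.finite_range c).bddBelow
  obtain ⟨w, hw, hwA⟩ := exists_pos_separating hA hAc hAu (a := a) ⟨x₀, hx₀, ha⟩ (c := c₀)
    (fun y ⟨x, hx, hxy⟩ hya i => by
      have h1 := hc i x ⟨hx, fun j => (hxy j).trans (EReal.coe_le_coe_iff.2 (hya j))⟩
      have h2 := EReal.coe_le_coe_iff.1 (h1.trans (hxy i))
      exact (hc₀ (mem_range_self i)).trans h2)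
    (p := p) (fun ⟨x, hx, hxp⟩ => hp x hx hxp)
  exact ⟨w, hw, fun x hx y hxy => hwA y ⟨x, hx, hxy⟩⟩

end FiniteFamily

/-! ### Lagrangians and weak duality in the extended reals. -/

section Lagrangian

variable {X T : Type*} {f : X → EReal} {F : T → X → EReal}

theorem ereal_sum_ne_bot {ι : Type*} {s : Finset ι} {g : ι → EReal} (hg : ∀ i ∈ s, g i ≠ ⊥) :
    ∑ i ∈ s, g i ≠ ⊥ :=
  Finset.sum_induction g (· ≠ ⊥) (fun _ _ ha hb => EReal.add_ne_bot_iff.2 ⟨ha, hb⟩) (by simp) hg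

theorem ereal_sum_eq_top {ι : Type*} {s : Finset ι} {g : ι → EReal} (hg : ∀ i ∈ s, g i ≠ ⊥)
    {j : ι} (hj : j ∈ s) (hgj : g j = ⊤) : ∑ i ∈ s, g i = ⊤ := by
  classical
  rw [← Finset.add_sum_erase s g hj, hgj]
  exact EReal.top_add_of_ne_bot (ereal_sum_ne_bot fun i hi => hg i (Finset.mem_of_mem_erase hi))

theorem coe_ereal_sum {ι : Type*} (s : Finset ι) (g : ι → ℝ) :
    ((∑ i ∈ s, g i : ℝ) : EReal) = ∑ i ∈ s, (g i : EReal) :=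
  map_sum (⟨⟨Real.toEReal, EReal.coe_zero⟩, EReal.coe_add⟩ : ℝ →+ EReal) g s

theorem lagrangian_le {H : Finset T} (μ : H → ℝ≥0) {x : X} {r : ℝ} {y : H → ℝ}
    (hf : f x ≤ (r : EReal)) (hF : ∀ k : H, F k x ≤ (y k : EReal)) :
    lagrangian f F H μ x ≤ ((r + ∑ k : H, (μ k : ℝ) * y k : ℝ) : EReal) := by
  rw [EReal.coe_add, coe_ereal_sum]
  refine add_le_add hf (Finset.sum_le_sum fun k _ => ?_)
  rw [EReal.coe_mul]
  exact mul_le_mul_of_nonneg_left (hF k) (EReal.coe_nonneg.2 (μ k).2)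

/-- Positivity of the multipliers is essential: as 0 * ⊤ = 0, a zero multiplier would drop a
constraint with value ⊤, about which the real levels in `h` say nothing. Here such points give the
value ⊤. -/
theorem le_lagrangian_of_pos {H : Finset T} {μ : H → ℝ≥0} (hμ : ∀ k, 0 < μ k) {x : X}
    (hf : f x ≠ ⊥) (hF : ∀ k : H, F k x ≠ ⊥) {α : ℝ}
    (h : ∀ (r : ℝ) (y : H → ℝ), f x ≤ (r : EReal) → (∀ k : H, F k x ≤ (y k : EReal)) →
      α ≤ r + ∑ k : H, (μ k : ℝ) * y k) :
    (α : EReal) ≤ lagrangian f F H μ x := by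
  have hterm : ∀ k ∈ (Finset.univ : Finset H), ((μ k : ℝ) : EReal) * F k x ≠ ⊥ := by
    intro k _
    have hk : (0 : ℝ) < μ k := hμ k
    rcases eq_or_ne (F k x) ⊤ with ht | ht
    · rw [ht, EReal.coe_mul_top_of_pos hk]
      exact top_ne_bot
    · lift F k x to ℝ using ⟨ht, hF k⟩ with b
      exact EReal.coe_ne_bot (μ k * b)
  by_cases hft : f x = ⊤
  · simp only [lagrangian, hft]
    rw [EReal.top_add_of_ne_bot (ereal_sum_ne_bot hterm)]
    exact le_top
  by_cases hFt : ∃ k : H, F k x = ⊤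
  · obtain ⟨k, hk⟩ := hFt
    have : ∑ t : H, ((μ t : ℝ) : EReal) * F t x = ⊤ := by
      refine ereal_sum_eq_top hterm (Finset.mem_univ k) ?_
      rw [hk]
      exact EReal.coe_mul_top_of_pos (hμ k)
    rw [lagrangian, this, EReal.add_top_of_ne_bot hf]
    exact le_top
  · push Not at hFt
    have hfe : f x = ((f x).toReal : EReal) := (EReal.coe_toReal hft hf).symm
    have hFe : ∀ k : H, F k x = ((F k x).toReal : EReal) := fun k =>
      (EReal.coe_toReal (hFt k) (hF k)).symm
    have h1 := h _ _ hfe.le fun k => (hFe k).le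
    have h2 : lagrangian f F H μ x =
        (((f x).toReal + ∑ k : H, (μ k : ℝ) * (F k x).toReal : ℝ) : EReal) := by
      rw [lagrangian, EReal.coe_add, coe_ereal_sum, ← hfe]
      congr 1
      refine Finset.sum_congr rfl fun k _ => ?_
      rw [EReal.coe_mul, ← hFe k]
    rw [h2]
    exact EReal.coe_le_coe_iff.2 h1

theorem infP_mono {S S' : Set T} (h : S ⊆ S') : infP f F S ≤ infP f F S' :=
  biInf_mono fun _ hx t ht => hx t (h ht)

theorem add_sum_le_of_feasible {s : Finset T} {c : T → ℝ≥0} {x : X}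
    (hx : ∀ t ∈ s, F t x ≤ 0) : f x + ∑ t ∈ s, ((c t : ℝ) : EReal) * F t x ≤ f x := by
  have : ∑ t ∈ s, ((c t : ℝ) : EReal) * F t x ≤ 0 := by
    refine Finset.sum_nonpos fun t ht => ?_
    have := mul_le_mul_of_nonneg_left (hx t ht) (EReal.coe_nonneg.2 (c t).2)
    rwa [mul_zero] at this
  simpa using add_le_add_right this (f x)

theorem supD_le_infP : supD f F ≤ infP f F univ :=
  iSup_le fun _ => le_iInf₂ fun x hx =>
    (iInf_le _ x).trans (add_sum_le_of_feasible fun t _ => hx t (mem_univ t))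

theorem supDFin_le_infP (H : Finset T) : supDFin f F H ≤ infP f F (H : Set T) := by
  classical
  refine iSup_le fun μ => le_iInf₂ fun x hx => (iInf_le _ x).trans ?_
  have : ∑ t : H, ((μ t : ℝ) : EReal) * F t x ≤ 0 := by
    refine Finset.sum_nonpos fun t _ => ?_
    have := mul_le_mul_of_nonneg_left (hx t t.2) (EReal.coe_nonneg.2 (μ t).2)
    rwa [mul_zero] at this
  simpa [lagrangian] using add_le_add_right this (f x)

theorem supDFin_le_supD (H : Finset T) : supDFin f F H ≤ supD f F := by
  classical
  refine iSup_le fun μ => ?_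
  let c : T → ℝ≥0 := fun t => if h : t ∈ H then μ ⟨t, h⟩ else 0
  let l : T →₀ ℝ≥0 := Finsupp.onFinset H c fun t ht => by
    by_contra hH
    exact ht (dif_neg hH)
  refine le_iSup_of_le l (iInf_mono fun x => le_of_eq ?_)
  rw [lagrangian]
  congr 1
  calc ∑ t : H, ((μ t : ℝ) : EReal) * F t x
      = ∑ t : H, ((l t : ℝ) : EReal) * F t x := by
        refine Finset.sum_congr rfl fun t _ => ?_
        have : l t = μ t := dif_pos t.2
        rw [this]
    _ = ∑ t ∈ H, ((l t : ℝ) : EReal) * F t x :=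
        Finset.sum_coe_sort H fun t => ((l t : ℝ) : EReal) * F t x
    _ = ∑ t ∈ l.support, ((l t : ℝ) : EReal) * F t x := by
        refine (Finset.sum_subset Finsupp.support_onFinset_subset fun t _ ht => ?_).symm
        rw [Finsupp.notMem_support_iff.1 ht]
        simp

end Lagrangian

/-! ### Joint sublevel sets and the recession space. -/

theorem locallyCompactSpace_of_isClosed_subset {E : Type*} [TopologicalSpace E] {A B : Set E} (hA : IsClosed A) (hAB : A ⊆ B)
    (hB : LocallyCompactSpace B) : LocallyCompactSpace A :=
  (Topology.IsClosedEmbedding.of_continuous_injective_isClosedMap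
    (continuous_inclusion hAB) (inclusion_injective hAB)
    (fun s hs => by
      obtain ⟨t, ht, rfl⟩ := isClosed_induced_iff.1 hs
      refine isClosed_induced_iff.2 ⟨t ∩ A, ht.inter hA, ?_⟩
      ext x
      constructor
      · rintro ⟨hx, hxA⟩
        exact ⟨⟨x, hxA⟩, hx, rfl⟩
      · rintro ⟨y, hy, rfl⟩
        exact ⟨hy, y.2⟩)).locallyCompactSpace

theorem mem_recConeP {E : Type*} [AddCommGroup E] [Module ℝ E] {f : E → EReal}
    {F : ℕ+ → E → EReal} {d : E} :
    d ∈ recConeP f F ↔ recFun f d ≤ 0 ∧ ∀ k, recFun (F k) d ≤ 0 := by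
  simp [recConeP, and_comm]

section Program

variable {E : Type*} [AddCommGroup E] [Module ℝ E] [TopologicalSpace E]

variable {f : E → EReal} {F : ℕ+ → E → EReal}

theorem apply_add_eq_of_mem_recConeP (hf : IsGamma f) (hF : ∀ k, IsGamma (F k))
    {L : Submodule ℝ E} (hL : recConeP f F = L) {d : E} (hd : d ∈ L) (x : E) :
    f (x + d) = f x ∧ ∀ k, F k (x + d) = F k x := by
  have h1 := mem_recConeP.1 (hL.ge hd)
  have h2 := mem_recConeP.1 (hL.ge (L.neg_mem hd))
  exact ⟨apply_add_eq_of_recFun_le_zero hf.proper.2 h1.1 h2.1 x,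
    fun k => apply_add_eq_of_recFun_le_zero (hF k).proper.2 (h1.2 k) (h2.2 k) x⟩

/-- Joint sublevel set of the objective and the constraints with index in `S`. -/
def jointSublevel (f : E → EReal) (F : ℕ+ → E → EReal) (S : Set ℕ+) (r : ℝ) (y : ℕ+ → ℝ) : Set E :=
  {x | f x ≤ (r : EReal) ∧ ∀ k ∈ S, F k x ≤ (y k : EReal)}

theorem isClosed_jointSublevel (hf : IsGamma f) (hF : ∀ k, IsGamma (F k)) (S : Set ℕ+) (r : ℝ)
    (y : ℕ+ → ℝ) : IsClosed (jointSublevel f F S r y) := by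
  have : jointSublevel f F S r y =
      {x | f x ≤ (r : EReal)} ∩ ⋂ k ∈ S, {x | F k x ≤ (y k : EReal)} := by
    ext x; simp [jointSublevel]
  rw [this]
  exact (hf.isClosed_sublevel r).inter (isClosed_biInter fun k _ => (hF k).isClosed_sublevel _)

theorem convex_jointSublevel (hf : IsGamma f) (hF : ∀ k, IsGamma (F k)) (S : Set ℕ+) (r : ℝ)
    (y : ℕ+ → ℝ) : Convex ℝ (jointSublevel f F S r y) := by
  have : jointSublevel f F S r y =
      {x | f x ≤ (r : EReal)} ∩ ⋂ k ∈ S, {x | F k x ≤ (y k : EReal)} := by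
    ext x; simp [jointSublevel]
  rw [this]
  exact (convex_sublevel_of_convex_epi hf.convex r).inter
    (convex_iInter₂ fun k _ => convex_sublevel_of_convex_epi (hF k).convex _)

omit [AddCommGroup E] [Module ℝ E] in
-- Bounds on f and on the first N constraints bound the Lagrangian. This is how hypothesis (g)
-- reaches the joint sublevel sets.
theorem locallyCompactSpace_of_subset_jointSublevel {N : ℕ+}
    {μ : (Finset.Icc 1 N : Finset ℕ+) → ℝ≥0}
    (hg : ∀ r : ℝ, LocallyCompactSpace {x | lagrangian f F (Finset.Icc 1 N) μ x ≤ (r : EReal)})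
    {A : Set E} (hA : IsClosed A) {r : ℝ} {y : ℕ+ → ℝ}
    (hsub : A ⊆ jointSublevel f F (Icc 1 N) r y) : LocallyCompactSpace A := by
  refine locallyCompactSpace_of_isClosed_subset hA (fun x hx => ?_)
    (hg (r + ∑ k : (Finset.Icc 1 N : Finset ℕ+), (μ k : ℝ) * y k))
  exact lagrangian_le μ (hsub hx).1 fun k => (hsub hx).2 k (Finset.mem_Icc.1 k.2)

variable [IsTopologicalAddGroup E] [ContinuousSMul ℝ E]

theorem ray_jointSublevel (hf : IsGamma f) (hF : ∀ k, IsGamma (F k)) {S : Set ℕ+} {r : ℝ}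
    {y : ℕ+ → ℝ} {x₀ d : E} (hx₀ : x₀ ∈ jointSublevel f F S r y) :
    (∀ t : ℝ, 0 ≤ t → x₀ + t • d ∈ jointSublevel f F S r y) ↔
      recFun f d ≤ 0 ∧ ∀ k ∈ S, recFun (F k) d ≤ 0 := by
  constructor
  · intro h
    exact ⟨hf.recFun_le_zero_of_ray fun t ht => (h t ht).1,
      fun k hk => (hF k).recFun_le_zero_of_ray fun t ht => (h t ht).2 k hk⟩
  · rintro ⟨h1, h2⟩ t ht
    exact ⟨recFun_le_zero_iff.1 h1 _ _ hx₀.1 t ht,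
      fun k hk => recFun_le_zero_iff.1 (h2 k hk) _ _ (hx₀.2 k hk) t ht⟩

variable [T2Space E]

/-- All functions are constant along L, so x₀ + L is a closed subset of a joint sublevel set. Thus L
is a locally compact Hausdorff vector space. -/
theorem finiteDimensional_of_recConeP (hf : IsGamma f) (hF : ∀ k, IsGamma (F k)) {N : ℕ+}
    {μ : (Finset.Icc 1 N : Finset ℕ+) → ℝ≥0}
    (hg : ∀ r : ℝ, LocallyCompactSpace {x | lagrangian f F (Finset.Icc 1 N) μ x ≤ (r : EReal)})
    {x₀ : E} {r₀ : ℝ} {y₀ : ℕ+ → ℝ} (hx₀ : x₀ ∈ jointSublevel f F univ r₀ y₀)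
    {L : Submodule ℝ E} (hL : recConeP f F = L) : FiniteDimensional ℝ L := by
  have hLc : IsClosed (L : Set E) := by
    rw [← hL, recConeP]
    exact (isClosed_iInter fun k => (hF k).isClosed_recFun_le_zero).inter hf.isClosed_recFun_le_zero
  have hemb : Topology.IsClosedEmbedding (fun d : L => x₀ + (d : E)) :=
    (Homeomorph.addLeft x₀).isClosedEmbedding.comp hLc.isClosedEmbedding_subtypeVal
  have hlc : LocallyCompactSpace (range fun d : L => x₀ + (d : E)) := by
    refine locallyCompactSpace_of_subset_jointSublevel hg hemb.isClosed_range (r := r₀) (y := y₀) ?_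
    rintro _ ⟨d, rfl⟩
    have := apply_add_eq_of_mem_recConeP hf hF hL d.2 x₀
    exact ⟨this.1 ▸ hx₀.1, fun k _ => this.2 k ▸ hx₀.2 k (mem_univ k)⟩
  have : LocallyCompactSpace L := hemb.isEmbedding.toHomeomorph.isClosedEmbedding.locallyCompactSpace
  exact FiniteDimensional.of_locallyCompactSpace ℝ

variable [LocallyConvexSpace ℝ E]

/-- On a closed complement of the recession space, the joint sublevel sets of finitely many
constraints are eventually compact. -/
theorem exists_isCompact_inter_jointSublevel (hf : IsGamma f) (hF : ∀ k, IsGamma (F k)) {N : ℕ+}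
    {μ : (Finset.Icc 1 N : Finset ℕ+) → ℝ≥0}
    (hg : ∀ r : ℝ, LocallyCompactSpace {x | lagrangian f F (Finset.Icc 1 N) μ x ≤ (r : EReal)})
    {x₀ : E} {r₀ : ℝ} {y₀ : ℕ+ → ℝ} (hx₀ : x₀ ∈ jointSublevel f F univ r₀ y₀)
    {L Y : Submodule ℝ E} (hL : recConeP f F = L) (hY : IsClosed (Y : Set E)) (hLY : Disjoint L Y) :
    ∃ m₀ : ℕ+, ∀ m ≥ m₀, ∀ (r : ℝ) (y : ℕ+ → ℝ),
      IsCompact ((Y : Set E) ∩ jointSublevel f F (Icc 1 m) r y) := by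
  -- G m is the recession cone of any nonempty joint sublevel set of the first m constraints within
  -- Y.
  let G : ℕ+ → Set E := fun m =>
    (Y : Set E) ∩ ({d | recFun f d ≤ 0} ∩ ⋂ k ∈ Icc 1 m, {d | recFun (F k) d ≤ 0})
  have hmem : ∀ {m d}, d ∈ G m ↔
      d ∈ Y ∧ recFun f d ≤ 0 ∧ ∀ k ∈ Icc 1 m, recFun (F k) d ≤ 0 := by
    intro m d; simp [G]
  have hcl : ∀ m, IsClosed (G m) := fun m =>
    hY.inter (hf.isClosed_recFun_le_zero.inter
      (isClosed_biInter fun k _ => (hF k).isClosed_recFun_le_zero))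
  have hzero : ∀ {h : E → EReal}, recFun h 0 ≤ 0 := fun {h} => by
    rw [recFun_le_zero_iff]; intro x r hx t _; simpa using hx
  have hlc : LocallyCompactSpace (G N) := by
    have hcl' : IsClosed (Homeomorph.addLeft x₀ '' G N) :=
      (Homeomorph.addLeft x₀).isClosedEmbedding.isClosedMap _ (hcl N)
    have : LocallyCompactSpace (Homeomorph.addLeft x₀ '' G N) := by
      refine locallyCompactSpace_of_subset_jointSublevel hg hcl' (r := r₀) (y := y₀) ?_
      rintro _ ⟨d, hd, rfl⟩
      have hx : x₀ ∈ jointSublevel f F (Icc 1 N) r₀ y₀ := ⟨hx₀.1, fun k _ => hx₀.2 k (mem_univ k)⟩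
      simpa using (ray_jointSublevel hf hF hx).2 (hmem.1 hd).2 1 zero_le_one
    exact ((Homeomorph.addLeft x₀).image (G N)).isClosedEmbedding.locallyCompactSpace
  obtain ⟨m₀, hm₀N, hm₀⟩ := exists_cone_subset_zero (G := G)
    (fun m m' hmm' d hd => by
      rw [hmem] at hd ⊢
      exact ⟨hd.1, hd.2.1, fun k hk => hd.2.2 k ⟨hk.1, hk.2.trans hmm'⟩⟩)
    hcl
    (fun m d hd t ht => by
      rw [hmem] at hd ⊢
      exact ⟨Y.smul_mem t hd.1, recFun_smul_le_zero hd.2.1 ht,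
        fun k hk => recFun_smul_le_zero (hd.2.2 k hk) ht⟩)
    (fun m => hmem.2 ⟨Y.zero_mem, hzero, fun _ _ => hzero⟩) hlc
    (fun d hd => by
      have hdL : d ∈ (L : Set E) := by
        rw [← hL, mem_recConeP]
        exact ⟨(hmem.1 (hd 1)).2.1, fun k => (hmem.1 (hd k)).2.2 k ⟨one_le, le_rfl⟩⟩
      exact Submodule.disjoint_def.1 hLY d hdL (hmem.1 (hd 1)).1)
  refine ⟨m₀, fun m hm r y => ?_⟩
  have hAc : IsClosed ((Y : Set E) ∩ jointSublevel f F (Icc 1 m) r y) :=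
    hY.inter (isClosed_jointSublevel hf hF _ r y)
  rcases ((Y : Set E) ∩ jointSublevel f F (Icc 1 m) r y).eq_empty_or_nonempty with he | ⟨a, ha⟩
  · rw [he]; exact isCompact_empty
  refine isCompact_of_locallyCompact_of_no_ray hAc
    (Y.convex.inter (convex_jointSublevel hf hF _ r y)) ?_ ha fun d hd => hm₀ d ?_
  · exact locallyCompactSpace_of_subset_jointSublevel hg hAc (r := r) (y := y) fun x hx =>
      ⟨hx.2.1, fun k hk => hx.2.2 k ⟨hk.1, hk.2.trans (hm₀N.trans hm)⟩⟩
  · have h1 := (ray_jointSublevel hf hF ha.2).1 fun t ht => (hd t ht).2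
    refine hmem.2 ⟨?_, h1.1, fun k hk => h1.2 k ⟨hk.1, hk.2.trans hm⟩⟩
    have : a + (1 : ℝ) • d ∈ Y := (hd 1 zero_le_one).1
    simpa using Y.sub_mem this ha.1

end Program

/-! ### Multipliers, strong duality and the solution set. -/

section Duality

variable {E : Type*} [AddCommGroup E] [Module ℝ E] [TopologicalSpace E]
  {f : E → EReal} {F : ℕ+ → E → EReal}

/-- The level α for f and 0 for the first m constraints is not attainable on Y, so positive weights
separate it from the attainable levels. Dividing by the weight of f, which needs no constraint
qualification to be nonzero, gives the multiplier; invariance extends the bound from Y to all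
points. -/
theorem exists_multiplier (hf : IsGamma f) (hF : ∀ k, IsGamma (F k)) {m : ℕ+} {Y : Submodule ℝ E}
    (hK : ∀ (r : ℝ) (y : ℕ+ → ℝ), IsCompact ((Y : Set E) ∩ jointSublevel f F (Icc 1 m) r y))
    (hYinv : ∀ x, ∃ x' ∈ Y, f x' = f x ∧ ∀ k, F k x' = F k x)
    {x₀ : E} {r₀ : ℝ} {y₀ : ℕ+ → ℝ} (hx₀ : x₀ ∈ jointSublevel f F univ r₀ y₀) {α : ℝ}
    (hα : (Y : Set E) ∩ jointSublevel f F (Icc 1 m) α 0 = ∅) :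
    (α : EReal) ≤ supDFin f F (Finset.Icc 1 m) := by
  let H : Finset ℕ+ := Finset.Icc 1 m
  let h : Option H → E → EReal := fun o => o.elim f fun k => F k
  have hh : ∀ o, IsGamma (h o) := by
    rintro (_ | k)
    exacts [hf, hF k]
  have hlev : ∀ (y : Option H → ℝ),
      {x | x ∈ (Y : Set E) ∧ ∀ o, h o x ≤ (y o : EReal)} = (Y : Set E) ∩
        jointSublevel f F (Icc 1 m) (y none)
          (fun k => if hk : k ∈ H then y (some ⟨k, hk⟩) else 0) := by
    intro y
    ext x
    refine and_congr_right fun _ => ?_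
    rw [Option.forall]
    refine and_congr_right fun _ => ?_
    constructor
    · intro hx k hk
      have hk' : k ∈ H := Finset.mem_Icc.2 hk
      simpa [hk', h] using hx ⟨k, hk'⟩
    · rintro hx ⟨k, hk⟩
      simpa [hk, h] using hx k (Finset.mem_Icc.1 hk)
  obtain ⟨x₁, hx₁Y, hfx₁, hFx₁⟩ := hYinv x₀
  obtain ⟨w, hw, hwle⟩ := exists_pos_weights hh Y.convex (fun y => by rw [hlev]; exact hK _ _)
    (a := fun o => o.elim r₀ fun k => y₀ k) (x₀ := x₁) hx₁Y
    (by
      rintro (_ | k)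
      · exact hfx₁.trans_le hx₀.1
      · exact (hFx₁ k).trans_le (hx₀.2 k (mem_univ _)))
    (p := fun o => o.elim α fun _ => 0)
    (by
      intro x hx hle
      rw [eq_empty_iff_forall_notMem] at hα
      refine hα x ⟨hx, hle none, fun k hk => ?_⟩
      exact hle (some ⟨k, Finset.mem_Icc.2 hk⟩))
  have hw0 := hw none
  refine le_iSup_of_le
    (fun k => ⟨w (some k) / w none, (div_pos (hw _) hw0).le⟩) (le_iInf fun x => ?_)
  refine le_lagrangian_of_pos (fun k => ?_) (hf.proper.2 x) (fun k => (hF k).proper.2 x) ?_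
  · exact div_pos (hw (some k)) hw0
  intro r y hr hy
  obtain ⟨x', hx'Y, hfx', hFx'⟩ := hYinv x
  have := hwle x' hx'Y (fun o => o.elim r y) (by
    rintro (_ | k)
    · exact hfx'.trans_le hr
    · exact (hFx' k).trans_le (hy k))
  simp only [Fintype.sum_option, Option.elim_none, Option.elim_some, mul_zero,
    Finset.sum_const_zero, add_zero] at this
  have e : r + ∑ k : H, w (some k) / w none * y k =
      (w none * r + ∑ k : H, w (some k) * y k) / w none := by
    rw [add_div, mul_div_cancel_left₀ _ hw0.ne', Finset.sum_div]
    congr 1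
    exact Finset.sum_congr rfl fun k _ => by ring
  change α ≤ r + ∑ k : H, w (some k) / w none * y k
  rw [e, le_div_iff₀ hw0, mul_comm]
  exact this

variable [IsTopologicalAddGroup E] [ContinuousSMul ℝ E] [LocallyConvexSpace ℝ E] [T2Space E]

/-- Duality and solution set for convex programs with a locally compact Lagrangian and a linear
recession cone, for the given topology of `E`. -/
theorem program_duality (f : E → EReal) (F : ℕ+ → E → EReal)
    (hf : IsGamma f) (hF : ∀ k, IsGamma (F k)) (hfin : infP f F univ ≠ ⊤)
    (hg : ∃ (N : ℕ+) (μ : (Finset.Icc 1 N : Finset ℕ+) → ℝ≥0), ∀ r : ℝ,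
      LocallyCompactSpace {x | lagrangian f F (Finset.Icc 1 N) μ x ≤ (r : EReal)})
    (he : ∃ L : Submodule ℝ E, recConeP f F = (L : Set E)) :
    (∃ v : ℝ,
      (∃ x ∈ feasible F univ, f x = (v : EReal)) ∧
      infP f F univ = (v : EReal) ∧
      Tendsto (fun m : ℕ+ => infP f F (Icc 1 m)) atTop (𝓝 (v : EReal)) ∧
      Tendsto (fun m : ℕ+ => supDFin f F (Finset.Icc 1 m)) atTop (𝓝 (v : EReal)) ∧
      supD f F = (v : EReal)) ∧
    ∃ (C : Set E) (L : Submodule ℝ E),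
      IsCompact C ∧ Convex ℝ C ∧ FiniteDimensional ℝ L ∧ sol f F univ = C + (L : Set E) := by
  obtain ⟨N, μ, hg⟩ := hg
  obtain ⟨L, hL⟩ := he
  obtain ⟨x₀, hx₀F, r₀, hr₀⟩ : ∃ x₀ ∈ feasible F univ, ∃ r₀ : ℝ, f x₀ ≤ (r₀ : EReal) := by
    obtain ⟨x₀, hlt⟩ := iInf_lt_iff.1 (lt_top_iff_ne_top.2 hfin)
    obtain ⟨hx₀, hlt⟩ := iInf_lt_iff.1 hlt
    obtain ⟨r, hr, -⟩ := EReal.lt_iff_exists_real_btwn.1 hlt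
    exact ⟨x₀, hx₀, r, hr.le⟩
  have hx₀ : x₀ ∈ jointSublevel f F univ r₀ 0 := ⟨hr₀, hx₀F⟩
  have hLfd : FiniteDimensional ℝ L := finiteDimensional_of_recConeP hf hF hg hx₀ hL
  obtain ⟨Y, hYc, hLY⟩ :=
    (Submodule.ClosedComplemented.of_finiteDimensional (𝕜 := ℝ) L).exists_isClosed_isCompl
  have hdec : ∀ x, ∃ x' ∈ Y, x - x' ∈ L ∧ f x' = f x ∧ ∀ k, F k x' = F k x := by
    intro x
    obtain ⟨l, hl, y, hy, rfl⟩ := Submodule.mem_sup.1 (hLY.sup_eq_top.ge (Submodule.mem_top (x := x)))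
    have := apply_add_eq_of_mem_recConeP hf hF hL hl y
    rw [add_comm y l] at this
    exact ⟨y, hy, by simpa using hl, this.1.symm, fun k => (this.2 k).symm⟩
  obtain ⟨m₀, hm₀⟩ := exists_isCompact_inter_jointSublevel hf hF hg hx₀ hL hYc hLY.disjoint
  have hunivK : ∀ (r : ℝ) (y : ℕ+ → ℝ), IsCompact ((Y : Set E) ∩ jointSublevel f F univ r y) :=
    fun r y => (hm₀ m₀ le_rfl r y).of_isClosed_subset
      (hYc.inter (isClosed_jointSublevel hf hF _ r y))
      fun x hx => ⟨hx.1, hx.2.1, fun k _ => hx.2.2 k (mem_univ k)⟩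
  obtain ⟨x₁, hx₁Y, -, hfx₁, hFx₁⟩ := hdec x₀
  have hx₁ : x₁ ∈ (Y : Set E) ∩ jointSublevel f F univ r₀ 0 :=
    ⟨hx₁Y, hfx₁.trans_le hr₀, fun k hk => (hFx₁ k).trans_le (hx₀F k hk)⟩
  obtain ⟨z, hz, hmin⟩ :=
    (hf.lsc.lowerSemicontinuousOn _).exists_isMinOn ⟨x₁, hx₁⟩ (hunivK r₀ 0)
  have hzF : z ∈ feasible F univ := hz.2.2
  have hzmin : ∀ x ∈ feasible F univ, f z ≤ f x := by
    intro x hx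
    obtain ⟨x', hx'Y, -, hfx', hFx'⟩ := hdec x
    rw [← hfx']
    rcases le_total (f x') (r₀ : EReal) with hle | hle
    · exact hmin ⟨hx'Y, hle, fun k hk => (hFx' k).trans_le (hx k hk)⟩
    · exact hz.2.1.trans hle
  obtain ⟨v, hv⟩ : ∃ v : ℝ, f z = (v : EReal) :=
    ⟨(f z).toReal, (EReal.coe_toReal (hz.2.1.trans_lt (EReal.coe_lt_top _)).ne
      (hf.proper.2 z)).symm⟩
  have hinf : infP f F univ = (v : EReal) :=
    le_antisymm (hv ▸ iInf₂_le z hzF) (le_iInf₂ fun x hx => hv ▸ hzmin x hx)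
  have hdual : ∀ α : ℝ, α < v → ∃ m₁ : ℕ+, ∀ m ≥ m₁,
      (α : EReal) ≤ supDFin f F (Finset.Icc 1 m) := by
    intro α hα
    -- A point of Y common to all these sets would be feasible with value at most α < v.
    have hex : ∃ m₁ : ℕ+, ((Y : Set E) ∩ jointSublevel f F (Icc 1 m₀) α 0) ∩
        jointSublevel f F (Icc 1 m₁) α 0 = ∅ := by
      refine (hm₀ m₀ le_rfl α 0).elim_directed_family_closed _
        (fun m => isClosed_jointSublevel hf hF _ α 0) ?_ ?_
      · rw [eq_empty_iff_forall_notMem]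
        rintro x ⟨hx, hx'⟩
        rw [mem_iInter] at hx'
        have h1 := hzmin x fun k _ => (hx' k).2 k ⟨one_le, le_rfl⟩
        have h2 := h1.trans hx.2.1
        rw [hv, EReal.coe_le_coe_iff] at h2
        linarith
      · exact directed_of_isDirected_le fun m m' hmm' x hx =>
          ⟨hx.1, fun k hk => hx.2 k ⟨hk.1, hk.2.trans hmm'⟩⟩
    obtain ⟨m₁, hm₁⟩ := hex
    refine ⟨max m₀ m₁, fun m hm => ?_⟩
    refine exists_multiplier hf hF (hm₀ m (le_of_max_le_left hm))
      (fun x => (hdec x).imp fun x' hx' => ⟨hx'.1, hx'.2.2⟩) hx₀ ?_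
    rw [eq_empty_iff_forall_notMem] at hm₁ ⊢
    rintro x ⟨hxY, hx⟩
    exact hm₁ x ⟨⟨hxY, hx.1, fun k hk => hx.2 k ⟨hk.1, hk.2.trans (le_of_max_le_left hm)⟩⟩,
      hx.1, fun k hk => hx.2 k ⟨hk.1, hk.2.trans (le_of_max_le_right hm)⟩⟩
  have hDP : ∀ m : ℕ+, supDFin f F (Finset.Icc 1 m) ≤ infP f F (Icc 1 m) := fun m => by
    simpa using supDFin_le_infP (f := f) (F := F) (Finset.Icc 1 m)
  have hPv : ∀ m : ℕ+, infP f F (Icc 1 m) ≤ (v : EReal) := fun m =>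
    hinf ▸ infP_mono (subset_univ _)
  have hlim : Tendsto (fun m : ℕ+ => supDFin f F (Finset.Icc 1 m)) atTop (𝓝 (v : EReal)) := by
    refine tendsto_order.2 ⟨fun a ha => ?_, fun a ha =>
      Eventually.of_forall fun m => ((hDP m).trans (hPv m)).trans_lt ha⟩
    obtain ⟨α, haα, hαv⟩ := EReal.lt_iff_exists_real_btwn.1 ha
    obtain ⟨m₁, hm₁⟩ := hdual α (EReal.coe_lt_coe_iff.1 hαv)
    filter_upwards [eventually_ge_atTop m₁] with m hm
    exact haα.trans_le (hm₁ m hm)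
  refine ⟨⟨v, ⟨z, hzF, hv⟩, hinf, ?_, hlim, ?_⟩, ?_⟩
  · exact tendsto_of_tendsto_of_tendsto_of_le_of_le hlim tendsto_const_nhds hDP hPv
  · exact le_antisymm (hinf ▸ supD_le_infP)
      (le_of_tendsto' hlim fun m => supDFin_le_supD (Finset.Icc 1 m))
  -- The compact summand consists of the optimal points in Y.
  · refine ⟨(Y : Set E) ∩ jointSublevel f F univ v 0, L, hunivK v 0,
      Y.convex.inter (convex_jointSublevel hf hF _ v 0), hLfd, ?_⟩
    ext x
    rw [Set.mem_add]
    constructor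
    · rintro ⟨hxF, hx⟩
      obtain ⟨x', hx'Y, hsub, hfx', hFx'⟩ := hdec x
      exact ⟨x', ⟨hx'Y, (hfx'.trans (hx.trans hinf)).le,
        fun k hk => (hFx' k).trans_le (hxF k hk)⟩, x - x', hsub, by simp⟩
    · rintro ⟨y, ⟨-, hy⟩, l, hl, rfl⟩
      have := apply_add_eq_of_mem_recConeP hf hF hL hl y
      have hfeas : y + l ∈ feasible F univ := fun k hk => (this.2 k).trans_le (hy.2 k hk)
      refine ⟨hfeas, le_antisymm ?_ (iInf₂_le _ hfeas)⟩
      rw [this.1, hinf]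
      exact hy.1

end Duality

/-! ### Passage to the weak topology. -/

section WeakTopology

variable {X : Type*} [AddCommGroup X] [Module ℝ X] [TopologicalSpace X]
  [IsTopologicalAddGroup X] [ContinuousSMul ℝ X] [LocallyConvexSpace ℝ X]

instance : LocallyConvexSpace ℝ (WeakSpace ℝ X) :=
  inferInstanceAs (LocallyConvexSpace ℝ (WeakBilin (topDualPairing ℝ X).flip))

/-- By Mazur's theorem, functions of the class `Γ(X)` are weakly lower semicontinuous. -/
theorem IsGamma.weakSpace {h : X → EReal} (hh : IsGamma h) :
    IsGamma (X := WeakSpace ℝ X) (h ∘ (toWeakSpace ℝ X).symm) where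
  proper := hh.proper
  convex := hh.convex
  lsc := by
    -- Real levels suffice, since a real number lies strictly between any two distinct extended
    -- reals.
    have hclosed : ∀ r : ℝ, IsClosed
        {x : WeakSpace ℝ X | h ((toWeakSpace ℝ X).symm x) ≤ (r : EReal)} := by
      intro r
      have h1 := (convex_sublevel_of_convex_epi hh.convex r).toWeakSpace_closure ℝ
      rw [(hh.isClosed_sublevel r).closure_eq] at h1
      have h2 : {x : WeakSpace ℝ X | h ((toWeakSpace ℝ X).symm x) ≤ (r : EReal)} =
          toWeakSpace ℝ X '' {x | h x ≤ (r : EReal)} :=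
        ((toWeakSpace ℝ X).toEquiv.image_eq_preimage_symm {x | h x ≤ (r : EReal)}).symm
      rw [h2, h1]
      exact isClosed_closure
    intro x a ha
    obtain ⟨r, har, hr⟩ := EReal.lt_iff_exists_real_btwn.1 ha
    filter_upwards [(hclosed r).isOpen_compl.mem_nhds (not_le.2 hr)] with y hy
    exact har.trans (not_le.1 hy)

end WeakTopology

end InfConvex

theorem corollary7 {X : Type*} [AddCommGroup X] [Module ℝ X] [TopologicalSpace X]
    [IsTopologicalAddGroup X] [ContinuousSMul ℝ X] [LocallyConvexSpace ℝ X] [T2Space X]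
    (f : X → EReal) (F : ℕ+ → X → EReal)
    (hf : InfConvex.IsGamma f) (hF : ∀ k, InfConvex.IsGamma (F k))
    (hfin : InfConvex.infP f F Set.univ ≠ ⊤)
    (hg : ∃ (N : ℕ+) (μ : (Finset.Icc 1 N : Finset ℕ+) → ℝ≥0),
      InfConvex.WeaklyInfLocallyCompact (InfConvex.lagrangian f F (Finset.Icc 1 N) μ))
    (he : ∃ L : Submodule ℝ X, InfConvex.recConeP f F = (L : Set X)) :
    (∃ v : ℝ,
      (∃ x ∈ InfConvex.feasible F Set.univ, f x = (v : EReal)) ∧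
      InfConvex.infP f F Set.univ = (v : EReal) ∧
      Tendsto (fun m : ℕ+ => InfConvex.infP f F (Set.Icc 1 m)) atTop (𝓝 (v : EReal)) ∧
      Tendsto (fun m : ℕ+ => InfConvex.supDFin f F (Finset.Icc 1 m)) atTop (𝓝 (v : EReal)) ∧
      InfConvex.supD f F = (v : EReal)) ∧
    ∃ (C : Set X) (L : Submodule ℝ X),
      InfConvex.WeaklyCompact C ∧ Convex ℝ C ∧ FiniteDimensional ℝ L ∧
      InfConvex.sol f F Set.univ = C + (L : Set X) := by
  have hg' : ∃ (N : ℕ+) (μ : (Finset.Icc 1 N : Finset ℕ+) → ℝ≥0), ∀ r : ℝ,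
      LocallyCompactSpace {x : WeakSpace ℝ X |
        InfConvex.lagrangian (f ∘ (toWeakSpace ℝ X).symm)
          (fun k => F k ∘ (toWeakSpace ℝ X).symm) (Finset.Icc 1 N) μ x ≤ (r : EReal)} := by
    obtain ⟨N, μ, hg⟩ := hg
    refine ⟨N, μ, fun r => ?_⟩
    have := hg r
    rw [InfConvex.WeaklyLocallyCompact,
      show toWeakSpace ℝ X '' {x | InfConvex.lagrangian f F (Finset.Icc 1 N) μ x ≤ (r : EReal)} = _
        from (toWeakSpace ℝ X).toEquiv.image_eq_preimage_symm _] at this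
    exact this
  -- `WeakSpace ℝ X` is X with another topology. Recession cones, optimal values, convexity and
  -- dimension do not see the topology, so `he` and all conclusions except compactness carry over
  -- unchanged.
  obtain ⟨h1, C, L, hC, hconv, hfd, hsol⟩ :=
    InfConvex.program_duality (E := WeakSpace ℝ X) (f ∘ (toWeakSpace ℝ X).symm)
      (fun k => F k ∘ (toWeakSpace ℝ X).symm) hf.weakSpace (fun k => (hF k).weakSpace) hfin hg' he
  refine ⟨h1, C, L, ?_, hconv, hfd, hsol⟩
  have : IsCompact (toWeakSpace ℝ X '' C) := by
    rwa [show toWeakSpace ℝ X '' C = C from Set.image_id C]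
  exact this
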